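/- There is an absolute constant $C>0$ such that the following holds. Let $G$ be a finite, simple, undirected, connected $d$-regular graph on $n$ vertices, with one vertex $s$ designated as the sink, and let $\sigma\in\mathbb{N}^{V(G)}$ be an initial chip configuration with a total of $N=\sum_{v\ne s}\sigma_v$ chips on the non-sink vertices. Consider the greedy simulation algorithm: while the current configuration $\sigma$ is not terminal (i.e. some $v\neq s$ has $\sigma_v\ge \deg(v)$), choose a vertex $u\ne s$ maximizing $\lfloor \sigma_u/\deg(u)\rfloor$ (ties broken arbitrarily), let $k=\lfloor\sigma_u/\deg(u)\rfloor$, and perform $k$ simultaneous firings of $u$: replace $\sigma_u$ by $\sigma_u-k\deg(u)$ and add $k$ to $\sigma_v$ for every neighbour $v\neq s$ of $u$ (chips sent to the sink are discarded). Each execution of the loop body is one iteration. Then every execution of the algorithm reaches a terminal configuration after at most $C\,n^3\log(nN)$ iterations; that is, the algorithm terminates in $O(n^3\log(nN))$ iterations. (For $N=0$ the bound is read as $0$: no iteration is performed.) -/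

import Mathlib

namespace Sandpile

variable {V : Type*} [Fintype V] [DecidableEq V]

/-- With sink `s`, a configuration is terminal if no non-sink vertex is full.
The number of chips recorded on the sink itself is irrelevant. -/
def IsTerminal (G : SimpleGraph V) [DecidableRel G.Adj] (s : V) (σ : V → ℕ) : Prop :=
  ∀ v, v ≠ s → σ v < G.degree v

/-- The total number of chips on the non-sink vertices. -/
def totalChips (s : V) (σ : V → ℕ) : ℕ :=
  ∑ v ∈ Finset.univ.erase s, σ v

/-- The number of firings that `v` can perform with the chips it has now:
`⌊σ v / degree v⌋`. -/
def multiplicity (G : SimpleGraph V) [DecidableRel G.Adj] (σ : V → ℕ) (v : V) : ℕ :=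
  σ v / G.degree v

/-- The configuration after `u` has performed `k = ⌊σ u / degree u⌋` simultaneous firings:
`u` loses `k * degree u` chips and each non-sink neighbour of `u` receives `k` chips
(chips sent to the sink are discarded). -/
def fireAll (G : SimpleGraph V) [DecidableRel G.Adj] (s : V) (σ : V → ℕ) (u : V) : V → ℕ :=
  fun v =>
    if v = u then σ u - multiplicity G σ u * G.degree u
    else if v ≠ s ∧ G.Adj u v then σ v + multiplicity G σ u
    else σ v

/-- One iteration of the greedy algorithm: some non-sink vertex `u` maximizing
`⌊σ v / degree v⌋` over `v ≠ s` (ties broken arbitrarily) performs all its firings at once. -/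
def IsIteration (G : SimpleGraph V) [DecidableRel G.Adj] (s : V) (σ σ' : V → ℕ) : Prop :=
  ∃ u, u ≠ s ∧ (∀ v, v ≠ s → multiplicity G σ v ≤ multiplicity G σ u) ∧
    σ' = fireAll G s σ u

/-- `c` is an execution of the greedy simulation algorithm from `σ`: `c i` is the configuration
after `i` iterations. The while-loop continues as long as the configuration is not terminal;
once it is terminal, the algorithm has halted and the configuration stays put. -/
structure IsExecution (G : SimpleGraph V) [DecidableRel G.Adj] (s : V) (σ : V → ℕ)
    (c : ℕ → V → ℕ) : Prop where
  init : c 0 = σ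
  iterate : ∀ i, ¬ IsTerminal G s (c i) → IsIteration G s (c i) (c (i + 1))
  halt : ∀ i, IsTerminal G s (c i) → c (i + 1) = c i

/-- The loop body can always be executed when the loop condition holds. -/
theorem exists_isIteration (G : SimpleGraph V) [DecidableRel G.Adj] (s : V) (σ : V → ℕ)
    (h : ¬ IsTerminal G s σ) : ∃ σ', IsIteration G s σ σ' := by
  have hne : (Finset.univ.erase s).Nonempty := by
    unfold IsTerminal at h
    push Not at h
    obtain ⟨v, hv, _⟩ := h
    exact ⟨v, by simp [hv]⟩
  obtain ⟨u, hu, hmax⟩ := Finset.exists_max_image _ (multiplicity G σ) hne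
  exact ⟨_, u, by simpa using hu, fun v hv => hmax v (by simp [hv]), rfl⟩

/-- The algorithm has an execution from every configuration. -/
theorem exists_isExecution (G : SimpleGraph V) [DecidableRel G.Adj] (s : V) (σ : V → ℕ) :
    ∃ c, IsExecution G s σ c := by
  classical
  choose f hf using exists_isIteration G s
  let g : (V → ℕ) → V → ℕ := fun τ => if h : IsTerminal G s τ then τ else f τ h
  refine ⟨fun i => g^[i] σ, rfl, fun i h => ?_, fun i h => ?_⟩
  · simp only [Function.iterate_succ_apply']
    have : g (g^[i] σ) = f _ h := dif_neg h
    rw [this]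
    exact hf _ h
  · simp only [Function.iterate_succ_apply']
    exact dif_pos h

end Sandpile

/-! ### Distances, Dirichlet energy and hitting times on regular graphs. -/

namespace SimpleGraph

variable {V : Type*} [Fintype V] [DecidableEq V] {G : SimpleGraph V} [DecidableRel G.Adj]

/-! Let `h v` be the expected time for simple random walk from `v` to hit `s`, and weigh a
configuration by `Φ = ∑ v, h v * σ v`. As `d * h v - ∑ h w = d` off the sink, `k` firings lower `Φ`
by exactly `k * d`. By greediness every non-sink vertex holds fewer than `d * (k + 1) ≤ 2 * k * d`
chips; with `h ≤ 6 * n ^ 2` this gives `Φ ≤ 12 * n ^ 3 * k * d`. So each iteration removes at least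
a fraction `1 / (12 * n ^ 3)` of `Φ`, which starts at most `6 * n ^ 2 * N` and is at least `1` until
termination.

Regularity makes `h` quadratic in `n`: the energy of `h` is at most of order `n * d * max h`, and
distances are at most `3 * n / d`, so the degree cancels. -/

omit [Fintype V] [DecidableEq V] [DecidableRel G.Adj] in
/-- The vertices of a shortest walk, as a sequence. -/
theorem Connected.exists_geodesic (hG : G.Connected) (s x : V) :
    ∃ p : ℕ → V, p 0 = s ∧ p (G.dist s x) = x ∧
      (∀ i < G.dist s x, G.Adj (p i) (p (i + 1))) ∧ ∀ i ≤ G.dist s x, G.dist s (p i) = i := by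
  obtain ⟨w, hw⟩ := hG.exists_walk_length_eq_dist s x
  refine ⟨w.getVert, w.getVert_zero, hw ▸ w.getVert_length,
    fun i hi => w.adj_getVert_succ (hw ▸ hi), fun i hi => ?_⟩
  have h := length_eq_dist_of_subwalk hw (w.isSubwalk_take i)
  rw [← h, Walk.take_length, hw]
  exact min_eq_left hi

omit [DecidableEq V] in
/-- In a connected `d`-regular graph on `n` vertices, distances are at most `3 * n / d`. -/
theorem Connected.dist_mul_le_of_isRegularOfDegree (hG : G.Connected) {d : ℕ}
    (hd : G.IsRegularOfDegree d) (s x : V) : G.dist s x * d ≤ 3 * Fintype.card V := by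
  obtain ⟨p, -, -, -, hp⟩ := hG.exists_geodesic s x
  set l := G.dist s x
  have hcard : ∑ i ∈ Finset.range l, (G.neighborFinset (p i)).card = l * d := by
    simp [hd.degree_eq]
  have hswap : ∑ i ∈ Finset.range l, (G.neighborFinset (p i)).card =
      ∑ v : V, ((Finset.range l).filter fun i => G.Adj (p i) v).card := by
    simp only [Finset.card_eq_sum_ones, Finset.sum_filter, neighborFinset_eq_filter]
    exact Finset.sum_comm
  -- Vertices of the geodesic adjacent to `v` are at distance from `s` within one of that of `v`,
  -- and `i` is the distance of `p i`.
  have hle : ∀ v : V, ((Finset.range l).filter fun i => G.Adj (p i) v).card ≤ 3 := by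
    intro v
    have hsub : ((Finset.range l).filter fun i => G.Adj (p i) v) ⊆
        Finset.Icc (G.dist s v - 1) (G.dist s v + 1) := by
      intro i hi
      simp only [Finset.mem_filter, Finset.mem_range] at hi
      have h1 := hp i hi.1.le
      have h2 := dist_eq_one_iff_adj.2 hi.2
      have h3 := hG.dist_triangle (u := s) (v := p i) (w := v)
      have h4 := hG.dist_triangle (u := s) (v := v) (w := p i)
      rw [dist_comm (u := v)] at h4
      simp only [Finset.mem_Icc]
      omega
    refine (Finset.card_le_card hsub).trans ?_
    rw [Nat.card_Icc]
    omega
  rw [← hcard, hswap]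
  refine (Finset.sum_le_sum fun v _ => hle v).trans ?_
  simp [mul_comm]

/-- The variation of a function along a geodesic is controlled by its Dirichlet energy. -/
theorem Connected.sub_sq_le_dist_mul_energy (hG : G.Connected) (s x : V) (h : V → ℝ) :
    (h x - h s) ^ 2 ≤
      G.dist s x * ∑ i : V, ∑ j : V, if G.Adj i j then (h i - h j) ^ 2 else 0 := by
  obtain ⟨p, hp0, hpl, hadj, hp⟩ := hG.exists_geodesic s x
  set l := G.dist s x
  have htel : h x - h s = ∑ i ∈ Finset.range l, (h (p (i + 1)) - h (p i)) := by
    rw [Finset.sum_range_sub fun i => h (p i), hp0, hpl]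
  have hcs := sq_sum_le_card_mul_sum_sq (s := Finset.range l)
    (f := fun i => h (p (i + 1)) - h (p i))
  rw [htel]
  refine hcs.trans ?_
  rw [Finset.card_range]
  refine mul_le_mul_of_nonneg_left ?_ (Nat.cast_nonneg _)
  have hinj : Set.InjOn p (Finset.range l) := by
    intro i hi j hj hij
    rw [← hp i (Finset.mem_range.1 hi).le, ← hp j (Finset.mem_range.1 hj).le, hij]
  calc ∑ i ∈ Finset.range l, (h (p (i + 1)) - h (p i)) ^ 2
      ≤ ∑ i ∈ Finset.range l, ∑ j : V, if G.Adj (p i) j then (h (p i) - h j) ^ 2 else 0 := by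
        refine Finset.sum_le_sum fun i hi => ?_
        refine le_trans (le_of_eq ?_) (Finset.single_le_sum (fun j _ => ?_)
          (Finset.mem_univ (p (i + 1))))
        · rw [if_pos (hadj i (Finset.mem_range.1 hi))]
          ring
        · split_ifs <;> positivity
    _ = ∑ v ∈ (Finset.range l).image p, ∑ j : V,
          if G.Adj v j then (h v - h j) ^ 2 else 0 := by rw [Finset.sum_image hinj]
    _ ≤ _ := by
        refine Finset.sum_le_sum_of_subset_of_nonneg (Finset.subset_univ _) fun v _ _ => ?_
        exact Finset.sum_nonneg fun j _ => by split_ifs <;> positivity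

/-- On a connected graph, the Poisson equation with Dirichlet condition at one vertex is
solvable. -/
theorem Connected.exists_lapMatrix_mulVec_eq (hG : G.Connected) (s : V) (f : V → ℝ) :
    ∃ h : V → ℝ, h s = 0 ∧ ∀ v, v ≠ s → (G.lapMatrix ℝ).mulVec h v = f v := by
  -- Laplacian off `s`, evaluation at `s`. A kernel element has zero energy, so it is constant and
  -- equal to its value `0` at `s`; injectivity then gives surjectivity.
  let A : (V → ℝ) →ₗ[ℝ] (V → ℝ) := LinearMap.pi fun v =>
    if v = s then LinearMap.proj s else LinearMap.proj v ∘ₗ Matrix.toLin' (G.lapMatrix ℝ)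
  have hAs : ∀ h, A h s = h s := fun h => by simp [A]
  have hAv : ∀ h v, v ≠ s → A h v = (G.lapMatrix ℝ).mulVec h v := fun h v hv => by
    simp [A, hv]
  have hinj : Function.Injective A := by
    rw [← LinearMap.ker_eq_bot, LinearMap.ker_eq_bot']
    intro h hh
    have hs : h s = 0 := by rw [← hAs h, hh]; rfl
    have hE : Matrix.toLinearMap₂' ℝ (G.lapMatrix ℝ) h h = 0 := by
      rw [Matrix.toLinearMap₂'_apply']
      refine Finset.sum_eq_zero fun v _ => ?_
      by_cases hv : v = s
      · rw [hv, hs, zero_mul]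
      · rw [← hAv h v hv, hh, Pi.zero_apply, mul_zero]
    rw [lapMatrix_toLinearMap₂'_apply'_eq_zero_iff_forall_reachable] at hE
    ext v
    rw [hE v s (hG v s), hs, Pi.zero_apply]
  obtain ⟨h, hh⟩ := LinearMap.injective_iff_surjective.1 hinj fun v => if v = s then 0 else f v
  refine ⟨h, by simp [← hAs h, hh], fun v hv => ?_⟩
  simp [← hAv h v hv, hh, hv]

/-- The expected hitting times of `s` for the simple random walk on a connected `d`-regular
graph with `n` vertices are at most `6 * n ^ 2`. -/
theorem Connected.exists_hittingTime (hG : G.Connected) {d : ℕ} (hd : G.IsRegularOfDegree d)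
    (hd0 : 0 < d) (s : V) :
    ∃ h : V → ℝ, h s = 0 ∧ (∀ v, v ≠ s → 1 ≤ h v) ∧
      (∀ v, h v ≤ 6 * (Fintype.card V : ℝ) ^ 2) ∧
      ∀ v, v ≠ s → d * h v - ∑ w ∈ G.neighborFinset v, h w = d := by
  have hdR : (0 : ℝ) < d := Nat.cast_pos.2 hd0
  obtain ⟨h, hs, hL⟩ := hG.exists_lapMatrix_mulVec_eq s fun _ => (d : ℝ)
  have hL' : ∀ v, v ≠ s → d * h v - ∑ w ∈ G.neighborFinset v, h w = d := fun v hv => by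
    rw [← hd.degree_eq v, ← lapMatrix_mulVec_apply, hL v hv, hd.degree_eq]
  -- Minimum principle: at a minimum off `s` the Laplacian would be at most `0`, not `d`.
  have hnonneg : ∀ v, 0 ≤ h v := by
    obtain ⟨m, -, hm⟩ := Finset.exists_min_image Finset.univ h ⟨s, Finset.mem_univ s⟩
    have hms : m = s := by
      by_contra hne
      have h1 := hL' m hne
      have h2 : (G.neighborFinset m).card • h m ≤ ∑ w ∈ G.neighborFinset m, h w :=
        Finset.card_nsmul_le_sum _ _ _ fun w _ => hm w (Finset.mem_univ w)
      rw [card_neighborFinset_eq_degree, hd.degree_eq, nsmul_eq_mul] at h2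
      linarith
    intro v
    rw [← hs, ← hms]
    exact hm v (Finset.mem_univ v)
  refine ⟨h, hs, fun v hv => ?_, ?_, hL'⟩
  · have h1 := hL' v hv
    have h2 : 0 ≤ ∑ w ∈ G.neighborFinset v, h w := Finset.sum_nonneg fun w _ => hnonneg w
    nlinarith
  obtain ⟨x, -, hx⟩ := Finset.exists_max_image Finset.univ h ⟨s, Finset.mem_univ s⟩
  suffices hxle : h x ≤ 6 * (Fintype.card V : ℝ) ^ 2 from
    fun v => (hx v (Finset.mem_univ v)).trans hxle
  have hE : Matrix.toLinearMap₂' ℝ (G.lapMatrix ℝ) h h ≤ Fintype.card V * (d * h x) := by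
    rw [Matrix.toLinearMap₂'_apply', ← nsmul_eq_mul]
    refine Finset.sum_le_card_nsmul _ _ _ fun v _ => ?_
    by_cases hv : v = s
    · rw [hv, hs, zero_mul]
      exact mul_nonneg hdR.le (hnonneg x)
    · rw [hL v hv, mul_comm]
      exact mul_le_mul_of_nonneg_left (hx v (Finset.mem_univ v)) hdR.le
  -- The sum over ordered pairs counts each edge twice, hence the factor `2`.
  rw [lapMatrix_toLinearMap₂', div_le_iff₀ two_pos] at hE
  have hsq := hG.sub_sq_le_dist_mul_energy s x h
  rw [hs, sub_zero] at hsq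
  have hdist : (G.dist s x : ℝ) * d ≤ 3 * Fintype.card V := by
    exact_mod_cast hG.dist_mul_le_of_isRegularOfDegree hd s x
  have hsq' : h x ^ 2 ≤ 6 * (Fintype.card V : ℝ) ^ 2 * h x := by
    calc h x ^ 2 ≤ G.dist s x * (Fintype.card V * (d * h x) * 2) :=
          hsq.trans (mul_le_mul_of_nonneg_left hE (Nat.cast_nonneg _))
      _ = (G.dist s x * d) * (2 * Fintype.card V * h x) := by ring
      _ ≤ (3 * Fintype.card V) * (2 * Fintype.card V * h x) :=
          mul_le_mul_of_nonneg_right hdist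
            (mul_nonneg (by positivity) (hnonneg x))
      _ = _ := by ring
  rcases (hnonneg x).eq_or_lt with h0 | hpos
  · rw [← h0]
    positivity
  · exact le_of_mul_le_mul_right (by rwa [sq] at hsq') hpos

end SimpleGraph

/-! ### Geometric decay of the potential. -/

namespace Sandpile

variable {V : Type*} [Fintype V] [DecidableEq V] {G : SimpleGraph V} [DecidableRel G.Adj]

/-- Firing `u` decreases a linear potential `h` by the discrete Laplacian of `h` at `u`. -/
theorem sum_mul_fireAll {s u : V} (hu : u ≠ s) {h : V → ℝ} (hs : h s = 0) (σ : V → ℕ) :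
    ∑ v, h v * (fireAll G s σ u v : ℝ) = ∑ v, h v * (σ v : ℝ) -
      multiplicity G σ u * (G.degree u * h u - ∑ w ∈ G.neighborFinset u, h w) := by
  have hterm : ∀ v, h v * (fireAll G s σ u v : ℝ) = h v * (σ v : ℝ) -
      (if v = u then multiplicity G σ u * (G.degree u * h u) else 0) +
      if G.Adj u v then multiplicity G σ u * h v else 0 := by
    intro v
    unfold fireAll
    by_cases hvu : v = u
    · subst hvu
      have hle : multiplicity G σ v * G.degree v ≤ σ v := Nat.div_mul_le_self _ _
      simp only [if_true, G.loopless.irrefl, if_false, Nat.cast_sub hle]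
      push_cast
      ring
    · by_cases hvs : v = s
      -- Since `h s = 0`, discarding the chips sent to the sink does not affect the potential.
      · subst hvs
        simp [hs, hvu]
      · by_cases hadj : G.Adj u v
        · simp only [hvu, hvs, hadj, if_false, if_true, ne_eq, not_false_eq_true, and_self]
          push_cast
          ring
        · simp [hvu, hadj]
  simp only [hterm, Finset.sum_add_distrib, Finset.sum_sub_distrib]
  rw [Finset.sum_ite_eq' Finset.univ u, if_pos (Finset.mem_univ u), ← Finset.sum_filter,
    ← SimpleGraph.neighborFinset_eq_filter, ← Finset.mul_sum]
  ring

/-- The potential `∑ v, h v * σ v` of a configuration is at most the number of chips times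
a bound for `h`. -/
theorem sum_mul_le {s : V} {h : V → ℝ} (hs : h s = 0) {B : ℝ} (hB : ∀ v, h v ≤ B) (σ : V → ℕ) :
    ∑ v, h v * (σ v : ℝ) ≤ B * totalChips s σ := by
  rw [← Finset.add_sum_erase _ _ (Finset.mem_univ s), hs, zero_mul, zero_add, totalChips,
    Nat.cast_sum, Finset.mul_sum]
  exact Finset.sum_le_sum fun v _ => mul_le_mul_of_nonneg_right (hB v) (Nat.cast_nonneg _)

/-- A greedy iteration decreases the hitting-time potential by a constant factor. -/
theorem IsIteration.potential_le {s : V} {σ σ' : V → ℕ} (hit : IsIteration G s σ σ') {d : ℕ}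
    (hd : G.IsRegularOfDegree d) (hd0 : 0 < d) (hσ : ¬ IsTerminal G s σ) {h : V → ℝ}
    (hs : h s = 0) (hB : ∀ v, h v ≤ 6 * (Fintype.card V : ℝ) ^ 2)
    (hL : ∀ v, v ≠ s → d * h v - ∑ w ∈ G.neighborFinset v, h w = d) :
    ∑ v, h v * (σ' v : ℝ) ≤
      (1 - 1 / (12 * (Fintype.card V : ℝ) ^ 3)) * ∑ v, h v * (σ v : ℝ) := by
  obtain ⟨u, hu, hmax, rfl⟩ := hit
  rw [sum_mul_fireAll hu hs, hd.degree_eq, hL u hu]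
  set k := multiplicity G σ u
  have hk1 : 1 ≤ k := by
    unfold IsTerminal at hσ
    push Not at hσ
    obtain ⟨v, hv, hle⟩ := hσ
    refine le_trans ?_ (hmax v hv)
    rw [multiplicity, Nat.one_le_div_iff (by rw [hd.degree_eq]; exact hd0)]
    exact hle
  have hchips : totalChips s σ ≤ Fintype.card V * (2 * (k * d)) := by
    unfold totalChips
    refine (Finset.sum_le_card_nsmul _ _ (2 * (k * d)) fun v hv => ?_).trans ?_
    · have h1 := hmax v (Finset.ne_of_mem_erase hv)
      rw [multiplicity, hd.degree_eq] at h1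
      have h2 : σ v < d * (k + 1) := by
        refine (Nat.lt_mul_div_succ (σ v) hd0).trans_le ?_
        exact Nat.mul_le_mul_left d (Nat.succ_le_succ h1)
      nlinarith
    · rw [smul_eq_mul]
      exact Nat.mul_le_mul_right _ (Finset.card_le_univ _)
  have hn : (0 : ℝ) < Fintype.card V := Nat.cast_pos.2 (Fintype.card_pos_iff.2 ⟨s⟩)
  have hΦ : ∑ v, h v * (σ v : ℝ) ≤ 12 * (Fintype.card V : ℝ) ^ 3 * (k * d) := by
    refine (sum_mul_le hs hB σ).trans ?_
    have hc : (totalChips s σ : ℝ) ≤ Fintype.card V * (2 * (k * d)) := by exact_mod_cast hchips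
    refine (mul_le_mul_of_nonneg_left hc (by positivity)).trans (le_of_eq ?_)
    ring
  have hdiv : 1 / (12 * (Fintype.card V : ℝ) ^ 3) * ∑ v, h v * (σ v : ℝ) ≤ k * d := by
    rw [one_div, inv_mul_le_iff₀ (by positivity)]
    exact hΦ
  linarith

/-- A terminal configuration stays put for the rest of the execution. -/
theorem IsExecution.isTerminal_of_le {s : V} {σ : V → ℕ} {c : ℕ → V → ℕ}
    (hc : IsExecution G s σ c) {i j : ℕ} (hij : i ≤ j) (hi : IsTerminal G s (c i)) :
    IsTerminal G s (c j) := by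
  induction j, hij using Nat.le_induction with
  | base => exact hi
  | succ j _ ih => rwa [hc.halt j ih]

/-- If the execution is not yet terminal after `m` iterations, then
`m ≤ 12 * n ^ 3 * log (6 * n ^ 2 * N)`. -/
theorem IsExecution.le_of_not_isTerminal {s : V} {σ : V → ℕ} {c : ℕ → V → ℕ}
    (hc : IsExecution G s σ c) (hG : G.Connected) {d : ℕ} (hd : G.IsRegularOfDegree d)
    (hd0 : 0 < d) {m : ℕ} (hm : ¬ IsTerminal G s (c m)) :
    (m : ℝ) ≤ 12 * (Fintype.card V : ℝ) ^ 3 *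
      Real.log (6 * (Fintype.card V : ℝ) ^ 2 * totalChips s σ) := by
  obtain ⟨h, hs, h1, hB, hL⟩ := hG.exists_hittingTime hd hd0 s
  have hnat : 1 ≤ Fintype.card V := Fintype.card_pos_iff.2 ⟨s⟩
  have hn : (1 : ℝ) ≤ Fintype.card V := by exact_mod_cast hnat
  set K : ℝ := 12 * (Fintype.card V : ℝ) ^ 3
  have hK1 : 1 ≤ K := by
    have := one_le_pow₀ hn (n := 3)
    linarith
  have hK0 : 0 < K := one_pos.trans_le hK1
  have hr : 0 ≤ 1 - 1 / K := by
    rw [sub_nonneg, div_le_one hK0]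
    exact hK1
  have hdecay : ∀ i ≤ m, ∑ v, h v * (c i v : ℝ) ≤ (1 - 1 / K) ^ i * ∑ v, h v * (σ v : ℝ) := by
    intro i
    induction i with
    | zero => intro _; rw [hc.init, pow_zero, one_mul]
    | succ i ih =>
      intro hi
      have hnt : ¬ IsTerminal G s (c i) := fun ht => hm (hc.isTerminal_of_le (by omega) ht)
      refine ((hc.iterate i hnt).potential_le hd hd0 hnt hs hB hL).trans ?_
      rw [pow_succ' (1 - 1 / K), mul_assoc]
      exact mul_le_mul_of_nonneg_left (ih (by omega)) hr
  have hone : 1 ≤ ∑ v, h v * (c m v : ℝ) := by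
    unfold IsTerminal at hm
    push Not at hm
    obtain ⟨v, hv, hle⟩ := hm
    rw [hd.degree_eq] at hle
    have hcv : (1 : ℝ) ≤ c m v := by exact_mod_cast hd0.trans_le hle
    refine (one_le_mul_of_one_le_of_one_le (h1 v hv) hcv).trans ?_
    refine Finset.single_le_sum (f := fun v => h v * (c m v : ℝ)) (fun w _ => ?_)
      (Finset.mem_univ v)
    by_cases hw : w = s
    · simp [hw, hs]
    · exact mul_nonneg (zero_le_one.trans (h1 w hw)) (Nat.cast_nonneg _)
  have hexp : (1 - 1 / K) ^ m ≤ Real.exp (-(m / K)) := by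
    calc (1 - 1 / K) ^ m ≤ Real.exp (-(1 / K)) ^ m :=
          pow_le_pow_left₀ hr (Real.one_sub_le_exp_neg _) m
      _ = Real.exp (-(m / K)) := by
          rw [← Real.exp_nat_mul]
          congr 1
          ring
  have hfinal : 1 ≤ Real.exp (-(m / K)) * (6 * (Fintype.card V : ℝ) ^ 2 * totalChips s σ) := by
    refine (hone.trans (hdecay m le_rfl)).trans ?_
    exact (mul_le_mul_of_nonneg_left (sum_mul_le hs hB σ) (pow_nonneg hr m)).trans
      (mul_le_mul_of_nonneg_right hexp (by positivity))
  rw [Real.exp_neg, ← div_eq_inv_mul, one_le_div (Real.exp_pos _)] at hfinal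
  have hlog := (Real.le_log_iff_exp_le ((Real.exp_pos _).trans_le hfinal)).2 hfinal
  rwa [div_le_iff₀ hK0, mul_comm] at hlog

end Sandpile

theorem mainTheorem9 :
    ∃ C : ℝ, 0 < C ∧
      ∀ (V : Type*) [Fintype V] [DecidableEq V] (G : SimpleGraph V) [DecidableRel G.Adj]
        (d : ℕ) (s : V) (σ : V → ℕ) (c : ℕ → V → ℕ),
        G.Connected → G.IsRegularOfDegree d → Sandpile.IsExecution G s σ c →
          ∃ T : ℕ, Sandpile.IsTerminal G s (c T) ∧
            (T : ℝ) ≤ C * (Fintype.card V : ℝ) ^ 3 *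
              Real.log ((Fintype.card V : ℝ) * (Sandpile.totalChips s σ : ℝ)) := by
  -- `60 = 12 * 5`, the `5` coming from `hlog`; the remaining unit absorbs the rounding of the
  -- floor.
  refine ⟨61, by norm_num, fun V _ _ G _ d s σ c hG hd hc => ?_⟩
  by_cases hσ : Sandpile.IsTerminal G s σ
  · refine ⟨0, by rwa [hc.init], ?_⟩
    -- Here `N = 0` is possible; then `Real.log 0 = 0` makes the bound `0`.
    rw [Nat.cast_zero, ← Nat.cast_mul]
    exact mul_nonneg (by positivity) (Real.log_natCast_nonneg _)
  have hσ' := hσ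
  unfold Sandpile.IsTerminal at hσ'
  push Not at hσ'
  obtain ⟨v, hvs, hv⟩ := hσ'
  have hcard : 2 ≤ Fintype.card V := Fintype.one_lt_card_iff.2 ⟨v, s, hvs⟩
  have hd0 : 0 < d := by
    obtain ⟨w, hw⟩ := hG.exists_walk_length_eq_dist v s
    have hpos := hG.pos_dist_of_ne hvs
    have hadj := w.adj_getVert_succ (i := 0) (by omega)
    rw [← hd.degree_eq (w.getVert 0), SimpleGraph.degree_pos_iff_exists_adj]
    exact ⟨_, hadj⟩
  have hN : 1 ≤ Sandpile.totalChips s σ := by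
    rw [hd.degree_eq] at hv
    refine (hd0.trans_le hv).trans_le ?_
    exact Finset.single_le_sum (f := σ) (fun _ _ => Nat.zero_le _)
      (Finset.mem_erase.2 ⟨hvs, Finset.mem_univ v⟩)
  have hn : (2 : ℝ) ≤ Fintype.card V := by exact_mod_cast hcard
  have hNR : (1 : ℝ) ≤ Sandpile.totalChips s σ := by exact_mod_cast hN
  set n : ℝ := (Fintype.card V : ℝ)
  set N : ℝ := (Sandpile.totalChips s σ : ℝ)
  have hlog : Real.log (6 * n ^ 2 * N) ≤ 5 * Real.log (n * N) := by
    refine (Real.log_le_log (y := (n * N) ^ 5) (by positivity) ?_).trans_eq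
      (by rw [Real.log_pow, Nat.cast_ofNat])
    -- The constant `6` is absorbed by `n ^ 3 ≥ 8`.
    have h3 : (2 : ℝ) ^ 3 ≤ n ^ 3 := pow_le_pow_left₀ two_pos.le hn 3
    have hN5 : N ≤ N ^ 5 := le_self_pow₀ hNR (by norm_num)
    calc 6 * n ^ 2 * N ≤ n ^ 3 * n ^ 2 * N ^ 5 := by gcongr; linarith
      _ = (n * N) ^ 5 := by ring
  have hlog2 : 1 / 2 ≤ Real.log (n * N) := by
    have h2 : (2 : ℝ) ≤ n * N := by nlinarith
    have := Real.log_le_log two_pos h2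
    linarith [Real.log_two_gt_d9]
  have hn3 : (8 : ℝ) ≤ n ^ 3 := by
    have := pow_le_pow_left₀ two_pos.le hn 3
    norm_num at this
    exact this
  refine ⟨⌊61 * n ^ 3 * Real.log (n * N)⌋₊, ?_, Nat.floor_le (by positivity)⟩
  by_contra hT
  have h1 := hc.le_of_not_isTerminal hG hd hd0 hT
  have h2 : 12 * n ^ 3 * Real.log (6 * n ^ 2 * N) ≤ 12 * n ^ 3 * (5 * Real.log (n * N)) :=
    mul_le_mul_of_nonneg_left hlog (by positivity)
  have h3 := Nat.lt_floor_add_one (61 * n ^ 3 * Real.log (n * N))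
  have h4 : 8 * (1 / 2) ≤ n ^ 3 * Real.log (n * N) :=
    mul_le_mul hn3 hlog2 (by norm_num) (by positivity)
  linarith
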